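/- Let $N\ge 1$ and let $f_1,\dots,f_N\in C^{\ell}([-1,1]^N)$ be real-valued with $\ell=\lceil \tfrac32 N\rceil+2$. Let $p_n$ be the Legendre polynomials on $[-1,1]$ ($p_0=1$, $p_1=x$, $(n+1)p_{n+1}=(2n+1)xp_n-np_{n-1}$), $P_n=\sqrt{n+\tfrac12}\,p_n$, and $P_{\vec k}(\theta)=\prod_{j=1}^N P_{k_j}(\theta_j)$ for $\vec k\in\{0,1,2,\dots\}^N$. For $M\ge 0$ let $$f_i^M(\theta)=\sum_{\|\vec k\|_\infty\le M}\alpha^{(i)}_{\vec k}P_{\vec k}(\theta),\qquad \alpha^{(i)}_{\vec k}=\int_{[-1,1]^N} f_i(\theta)P_{\vec k}(\theta)\,d\theta ,$$ be the order-$M$ tensor-Legendre least-squares (Galerkin) approximation of $f_i$, and put $\mathbf f=(f_1,\dots,f_N)^\top$, $\mathbf f^M=(f_1^M,\dots,f_N^M)^\top$. Let $\theta^\dagger\in(-1,1)^N$ satisfy $\mathbf f(\theta^\dagger)=0$, and suppose that the Jacobian matrix $\nabla \mathbf f(\theta^\dagger)$ is invertible. Then there is a sequence $(\theta^*_M)_{M\ge0}$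 in $[-1,1]^N$ such that, for every $M$, $\theta^*_M$ is a global minimizer of $$\theta\mapsto\sum_{i=1}^N \bigl(f_i^M(\theta)\bigr)^2\quad\text{over } [-1,1]^N,$$ and $\theta^*_M\to\theta^\dagger$ as $M\to\infty$. Moreover, $\mathbf f^M(\theta^*_M)\to 0$ as $M\to\infty$. -/

import Mathlib

open MeasureTheory Filter Topology

noncomputable section

namespace LegendreSurrogate

/-- The Legendre polynomials on `[-1,1]`: `p₀ = 1`, `p₁ = x` and
`(n + 1) pₙ₊₁ = (2 n + 1) x pₙ - n pₙ₋₁`. -/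
def legendre : ℕ → Polynomial ℝ
  | 0 => 1
  | 1 => Polynomial.X
  | n + 2 => Polynomial.C ((n + 2 : ℝ)⁻¹) *
      (Polynomial.C (2 * n + 3 : ℝ) * Polynomial.X * legendre (n + 1)
        - Polynomial.C (n + 1 : ℝ) * legendre n)

/-- The normalized Legendre function `Pₙ = √(n + 1/2) pₙ`, of norm one in `L²([-1,1], dx)`. -/
def normLegendre (n : ℕ) (x : ℝ) : ℝ :=
  Real.sqrt (n + 1 / 2) * (legendre n).eval x

/-- The tensor-product Legendre function `P_k(θ) = ∏ⱼ P_{kⱼ}(θⱼ)` of a multi-index `k`. -/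
def tensorLegendre {N : ℕ} (k : Fin N → ℕ) (θ : Fin N → ℝ) : ℝ :=
  ∏ j, normLegendre (k j) (θ j)

/-- The closed cube `[-1,1]^N`. -/
def cube (N : ℕ) : Set (Fin N → ℝ) :=
  {θ | ∀ j, θ j ∈ Set.Icc (-1 : ℝ) 1}

/-- The Galerkin (least-squares) coefficient `α_k = ∫_{[-1,1]^N} g P_k dθ`. -/
def coeff {N : ℕ} (g : (Fin N → ℝ) → ℝ) (k : Fin N → ℕ) : ℝ :=
  ∫ θ in cube N, g θ * tensorLegendre k θ

/-- The multi-indices `k` with `‖k‖_∞ ≤ M`. -/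
def multiIndices (N M : ℕ) : Finset (Fin N → ℕ) :=
  Fintype.piFinset fun _ => Finset.range (M + 1)

/-- The order-`M` surrogate `g^M = ∑_{‖k‖_∞ ≤ M} α_k P_k`. -/
def surrogate {N : ℕ} (M : ℕ) (g : (Fin N → ℝ) → ℝ) (θ : Fin N → ℝ) : ℝ :=
  ∑ k ∈ multiIndices N M, coeff g k * tensorLegendre k θ

/-- The Jacobian matrix `(∂fᵢ/∂θⱼ)(θ)`. -/
def jacobian {N : ℕ} (f : Fin N → (Fin N → ℝ) → ℝ) (θ : Fin N → ℝ) :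
    Matrix (Fin N) (Fin N) ℝ :=
  Matrix.of fun i j => fderiv ℝ (f i) θ (Pi.single j 1)

end LegendreSurrogate

end

noncomputable section

namespace LegendreSurrogate

/-! ### Legendre polynomials in one variable: identities, orthogonality, bounds -/

section OneVariable

open Polynomial

/-! Near `θd` the surrogates are small `C¹` perturbations of `f`. Since the Jacobian of `f` at `θd`
is invertible, a quantitative inverse function theorem (`eventually_exists_zero`) gives, for large
`M`, a common zero of all the surrogates as close to `θd` as desired. There the sum of squares is
zero, so such a point is a global minimizer. Other minimizers may exist far away; taking for each
`M` a minimizer nearest to `θd` forces convergence, and eventually the minimal value is exactly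
zero.

The analytic content is the `C¹` convergence. Integration by parts with `(2m+3) pₘ₊₁ = (pₘ₊₂ - pₘ)'`
gains one power of `k j` per derivative of `g`, so `C^s` regularity gives coefficients of size `(max
k + 1)^(-s)` (`exists_abs_coeff_mul_pow_le`). The energy bound for Legendre's equation controls `pₙ`
on `[-1,1]` and `pₙ'` by a multiple of `n + 1` on compact subsets of `(-1,1)`. One differentiated
term of the series thus costs `N/2 + 1` powers of `max k + 1`, and summability over `N` indices
costs `N + 1` more: altogether `3N/2 + 2`, which is where `ℓ` comes from
(`exists_abs_coeff_mul_le_weight`).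

Hence the series and its derivatives converge uniformly near `θd`. Completeness of the tensor
Legendre system (`eqOn_zero_of_coeff_eq_zero`) identifies the sum with `g`. -/

theorem legendre_rec (n : ℕ) :
    ((n : ℝ[X]) + 2) * legendre (n + 2)
      = (2 * (n : ℝ[X]) + 3) * X * legendre (n + 1) - ((n : ℝ[X]) + 1) * legendre n := by
  have h : ((n : ℝ[X]) + 2) * C ((n + 2 : ℝ)⁻¹) = 1 := by
    have h1 : ((n : ℝ[X]) + 2) = C (n + 2 : ℝ) := by simp [C_ofNat]
    rw [h1, ← C_mul, mul_inv_cancel₀ (by positivity), C_1]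
  have h2 : (C (2 * n + 3 : ℝ) : ℝ[X]) = 2 * n + 3 := by simp [C_ofNat]
  have h3 : (C (n + 1 : ℝ) : ℝ[X]) = n + 1 := by simp
  rw [legendre, ← mul_assoc, h, h2, h3, one_mul]

/-- The two identities need a joint induction: the second one eliminates `derivative (legendre n)`
from the differentiated recurrence, which yields the next instance of the first. -/
theorem derivative_legendre_aux (n : ℕ) :
    derivative (legendre (n + 1)) = X * derivative (legendre n) + ((n : ℝ[X]) + 1) * legendre n ∧
    X * derivative (legendre (n + 1)) - derivative (legendre n)
      = ((n : ℝ[X]) + 1) * legendre (n + 1) := by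
  induction n with
  | zero => simp [legendre]
  | succ n ih =>
    obtain ⟨h1, h2⟩ := ih
    have hrec := legendre_rec n
    have hd := congrArg derivative hrec
    simp only [derivative_mul, derivative_add, derivative_sub, derivative_natCast,
      derivative_X, derivative_ofNat, derivative_one] at hd
    have hne : ((n : ℝ[X]) + 2) ≠ 0 := by exact_mod_cast (by omega : n + 2 ≠ 0)
    have h3 : derivative (legendre (n + 2))
        = X * derivative (legendre (n + 1)) + ((n : ℝ[X]) + 2) * legendre (n + 1) := by
      apply mul_left_cancel₀ hne
      linear_combination hd + (-(n : ℝ[X]) - 1) * h2 * (-1)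
    refine ⟨?_, ?_⟩
    · push_cast
      linear_combination h3
    · push_cast
      linear_combination X * h3 - h1 + X * h2 - hrec

theorem derivative_legendre_succ (n : ℕ) :
    derivative (legendre (n + 1)) = X * derivative (legendre n) + ((n : ℝ[X]) + 1) * legendre n :=
  (derivative_legendre_aux n).1

theorem X_mul_derivative_legendre_succ (n : ℕ) :
    X * derivative (legendre (n + 1)) - derivative (legendre n) = ((n : ℝ[X]) + 1) * legendre (n + 1) :=
  (derivative_legendre_aux n).2

theorem derivative_legendre_sub (n : ℕ) :
    derivative (legendre (n + 2) - legendre n) = (2 * (n : ℝ[X]) + 3) * legendre (n + 1) := by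
  have h1 := derivative_legendre_succ (n + 1)
  have h2 := X_mul_derivative_legendre_succ n
  rw [derivative_sub]
  push_cast at h1
  linear_combination h1 + h2

/-- Legendre's differential equation. -/
theorem legendre_ode (n : ℕ) :
    derivative ((1 - X ^ 2) * derivative (legendre n)) =
      -((n : ℝ[X]) * ((n : ℝ[X]) + 1)) * legendre n := by
  cases n with
  | zero => simp [legendre]
  | succ n =>
    have h1 := derivative_legendre_succ n
    have h2 := X_mul_derivative_legendre_succ n
    have h3 : (1 - X ^ 2) * derivative (legendre (n + 1))
        = ((n : ℝ[X]) + 1) * (legendre n - X * legendre (n + 1)) := by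
      linear_combination h1 - X * h2
    rw [h3]
    simp only [derivative_mul, derivative_add, derivative_sub, derivative_natCast,
      derivative_X, derivative_one]
    push_cast
    linear_combination (-(n : ℝ[X]) - 1) * h2

theorem legendre_eval_one (n : ℕ) : (legendre n).eval 1 = 1 := by
  induction n using Nat.twoStepInduction with
  | zero => simp [legendre]
  | one => simp [legendre]
  | more n h1 h2 =>
    have h := congrArg (eval 1) (legendre_rec n)
    simp [h1, h2] at h
    have : (n + 2 : ℝ) ≠ 0 := by positivity
    apply mul_left_cancel₀ this
    linarith

theorem legendre_eval_neg_one (n : ℕ) : (legendre n).eval (-1) = (-1) ^ n := by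
  induction n using Nat.twoStepInduction with
  | zero => simp [legendre]
  | one => simp [legendre]
  | more n h1 h2 =>
    have h := congrArg (eval (-1)) (legendre_rec n)
    simp [h1, h2] at h
    have : (n + 2 : ℝ) ≠ 0 := by positivity
    apply mul_left_cancel₀ this
    rw [h]
    ring

theorem integral_derivative_eval (q : ℝ[X]) (a b : ℝ) :
    ∫ x in a..b, (derivative q).eval x = q.eval b - q.eval a :=
  intervalIntegral.integral_eq_sub_of_hasDerivAt (fun x _ => q.hasDerivAt x)
    ((derivative q).continuous.intervalIntegrable _ _)

/-- Sturm–Liouville argument: `1 - X ^ 2` times the Wronskian vanishes at `±1`, and its derivative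
is the product times the difference of the eigenvalues. -/
theorem integral_legendre_mul_legendre_of_ne {m n : ℕ} (h : m ≠ n) :
    ∫ x in (-1 : ℝ)..1, (legendre m * legendre n).eval x = 0 := by
  have hd : derivative ((1 - X ^ 2) * (legendre m * derivative (legendre n)
      - legendre n * derivative (legendre m)))
      = C ((m * (m + 1) - n * (n + 1) : ℝ)) * (legendre m * legendre n) := by
    have h1 := legendre_ode m
    have h2 := legendre_ode n
    have h4 : C ((m * (m + 1) - n * (n + 1) : ℝ)) = ((m * (m + 1) - n * (n + 1) : ℝ[X])) := by
      simp
    rw [h4]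
    simp only [derivative_mul, derivative_sub] at h1 h2 ⊢
    linear_combination legendre m * h2 - legendre n * h1
  have hi := integral_derivative_eval ((1 - X ^ 2) * (legendre m * derivative (legendre n)
      - legendre n * derivative (legendre m))) (-1) 1
  rw [hd] at hi
  simp only [eval_mul, eval_C, eval_sub, eval_pow, eval_X, eval_one,
    intervalIntegral.integral_const_mul] at hi ⊢
  have hne : (m * (m + 1) - n * (n + 1) : ℝ) ≠ 0 := by
    have : (m * (m + 1) - n * (n + 1) : ℝ) = (m - n) * (m + n + 1) := by ring
    rw [this]
    have : (m : ℝ) - n ≠ 0 := sub_ne_zero.2 (by exact_mod_cast h)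
    positivity
  norm_num at hi
  exact hi.resolve_left hne

theorem integral_legendre_sq (n : ℕ) :
    ∫ x in (-1 : ℝ)..1, (legendre n * legendre n).eval x = 2 / (2 * n + 1) := by
  have step : ∀ n : ℕ, (2 * n + 5 : ℝ) * ∫ x in (-1 : ℝ)..1,
        (legendre (n + 2) * legendre (n + 2)).eval x
      = (2 * n + 3) * ∫ x in (-1 : ℝ)..1, (legendre (n + 1) * legendre (n + 1)).eval x := by
    intro n
    -- Multiply the recurrence for `n` by `legendre (n + 2)` and the one for `n + 1` by `legendre (n
    -- + 1)`, then eliminate the common term in `x`. The mixed products integrate to zero.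
    have e1 : ∀ x : ℝ, (n + 2) * (2 * n + 5 : ℝ) * (legendre (n + 2) * legendre (n + 2)).eval x
        = (2 * n + 3) * (n + 2) * (legendre (n + 1) * legendre (n + 1)).eval x
          + (2 * n + 3) * (n + 3) * (legendre (n + 3) * legendre (n + 1)).eval x
          - (2 * n + 5) * (n + 1) * (legendre n * legendre (n + 2)).eval x := by
      intro x
      have h1 := congrArg (eval x) (legendre_rec n)
      have h2 := congrArg (eval x) (legendre_rec (n + 1))
      simp at h1 h2 ⊢
      linear_combination (2 * n + 5) * (legendre (n + 2)).eval x * h1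
        - (2 * n + 3) * (legendre (n + 1)).eval x * h2
    have e2 := congrArg (fun F : ℝ → ℝ => ∫ x in (-1 : ℝ)..1, F x) (funext e1)
    rw [intervalIntegral.integral_sub, intervalIntegral.integral_add] at e2
    · simp only [intervalIntegral.integral_const_mul] at e2
      rw [integral_legendre_mul_legendre_of_ne (by omega : n + 3 ≠ n + 1),
        integral_legendre_mul_legendre_of_ne (by omega : n ≠ n + 2)] at e2
      have : (n + 2 : ℝ) ≠ 0 := by positivity
      apply mul_left_cancel₀ this
      linarith
    all_goals
      apply Continuous.intervalIntegrable
      fun_prop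
  have key : ∀ n : ℕ, (2 * (n + 1 : ℕ) + 1 : ℝ) * ∫ x in (-1 : ℝ)..1,
      (legendre (n + 1) * legendre (n + 1)).eval x = 2 := by
    intro n
    induction n with
    | zero =>
      simp [legendre, ← pow_two, integral_pow]
      norm_num
    | succ n ih =>
      have := step n
      push_cast at ih this ⊢
      linarith
  cases n with
  | zero => simp [legendre]; norm_num
  | succ n =>
    rw [eq_div_iff (by positivity), mul_comm]
    exact key n

/-- The classical bound for the energy `p² + (1 - x²) p'² / (n (n + 1))` of a Legendre polynomial,
which is monotone in `|x|`. -/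
theorem legendre_energy_le (n : ℕ) {x : ℝ} (hx : x ∈ Set.Icc (-1 : ℝ) 1) :
    n * (n + 1) * (legendre n).eval x ^ 2 + (1 - x ^ 2) * (derivative (legendre n)).eval x ^ 2
      ≤ n * (n + 1) := by
  set p := legendre n with hp
  let F : ℝ[X] := C (n * (n + 1) : ℝ) * p ^ 2 + (1 - X ^ 2) * derivative p ^ 2
  have hF : ∀ y, F.eval y = n * (n + 1) * p.eval y ^ 2
      + (1 - y ^ 2) * (derivative p).eval y ^ 2 := fun y => by simp [F]
  have hF' : derivative F = 2 * X * derivative p ^ 2 := by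
    have h1 := legendre_ode n
    have h4 : C ((n * (n + 1) : ℝ)) = ((n * (n + 1) : ℝ[X])) := by simp
    rw [← hp] at h1
    simp only [F, h4, derivative_mul, derivative_add, derivative_sub, derivative_natCast,
      derivative_X, derivative_one, derivative_pow] at h1 ⊢
    simp only [map_natCast] at h1 ⊢
    push_cast at h1 ⊢
    linear_combination 2 * derivative p * h1
  rw [← hF]
  have hFe : ∀ y : ℝ, HasDerivAt (fun y => F.eval y) (2 * y * (derivative p).eval y ^ 2) y := by
    intro y
    have := F.hasDerivAt y
    rw [hF'] at this
    simpa using this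
  rcases le_total 0 x with h0 | h0
  · have hm : MonotoneOn (fun y => F.eval y) (Set.Icc 0 1) := by
      apply monotoneOn_of_deriv_nonneg (convex_Icc 0 1) F.continuous.continuousOn
        F.differentiable.differentiableOn
      intro y hy
      rw [interior_Icc] at hy
      rw [(hFe y).deriv]
      have := hy.1
      positivity
    have := hm ⟨h0, hx.2⟩ ⟨zero_le_one, le_rfl⟩ hx.2
    refine this.trans (le_of_eq ?_)
    simp only [hF, hp, legendre_eval_one]
    ring
  · have hm : AntitoneOn (fun y => F.eval y) (Set.Icc (-1) 0) := by
      apply antitoneOn_of_deriv_nonpos (convex_Icc _ _) F.continuous.continuousOn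
        F.differentiable.differentiableOn
      intro y hy
      rw [interior_Icc] at hy
      rw [(hFe y).deriv]
      have := hy.2
      nlinarith [sq_nonneg ((derivative p).eval y)]
    have := hm ⟨le_rfl, by norm_num⟩ ⟨hx.1, h0⟩ hx.1
    refine this.trans (le_of_eq ?_)
    have hs : (((-1 : ℝ) ^ n) ^ 2) = 1 := by rw [← pow_mul, mul_comm, pow_mul]; norm_num
    simp only [hF, hp, legendre_eval_neg_one, hs]
    ring

theorem abs_legendre_le_one (n : ℕ) {x : ℝ} (hx : x ∈ Set.Icc (-1 : ℝ) 1) :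
    |(legendre n).eval x| ≤ 1 := by
  rcases Nat.eq_zero_or_pos n with rfl | hn
  · simp [legendre]
  have h := legendre_energy_le n hx
  have h1 : 0 ≤ (1 - x ^ 2) * (derivative (legendre n)).eval x ^ 2 :=
    mul_nonneg (by nlinarith [hx.1, hx.2]) (sq_nonneg _)
  have hn' : (0 : ℝ) < n * (n + 1) := by positivity
  rw [← sq_le_one_iff_abs_le_one]
  nlinarith

/-- Away from the endpoints the energy bound gives linear growth in `n`, whereas the derivative at
`±1` grows quadratically. Linear growth is what the available smoothness can absorb. -/
theorem abs_derivative_legendre_le (n : ℕ) {x ρ : ℝ} (hρ : 0 ≤ ρ) (hρ1 : ρ < 1) (hx : |x| ≤ ρ) :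
    |(derivative (legendre n)).eval x| ≤ (n + 1) / √(1 - ρ ^ 2) := by
  have hx' : x ∈ Set.Icc (-1 : ℝ) 1 := abs_le.1 (hx.trans hρ1.le)
  have h := legendre_energy_le n hx'
  have hx2 : x ^ 2 ≤ ρ ^ 2 := sq_le_sq' (by linarith [(abs_le.1 hx).1]) (abs_le.1 hx).2
  have hpos : 0 < 1 - ρ ^ 2 := by nlinarith
  rw [le_div_iff₀ (Real.sqrt_pos.2 hpos)]
  refine le_of_sq_le_sq ?_ (by positivity)
  rw [mul_pow, Real.sq_sqrt hpos.le, sq_abs]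
  have : 0 ≤ n * (n + 1) * (legendre n).eval x ^ 2 := by positivity
  nlinarith [sq_nonneg ((derivative (legendre n)).eval x), (Nat.cast_nonneg n : (0 : ℝ) ≤ n)]

end OneVariable

/-! ### Integration over the cube -/

section Cube

variable {N : ℕ}

theorem cube_eq_Icc (N : ℕ) : cube N = Set.Icc (fun _ => (-1 : ℝ)) (fun _ => 1) := by
  ext θ
  simp only [cube, Set.mem_ofPred_eq, Set.mem_Icc, Pi.le_def]
  exact forall_and

theorem cube_eq_pi (N : ℕ) : cube N = Set.univ.pi fun _ => Set.Icc (-1 : ℝ) 1 := by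
  ext θ
  simp only [cube, Set.mem_ofPred_eq, Set.mem_pi, Set.mem_univ, true_implies]

theorem isCompact_cube (N : ℕ) : IsCompact (cube N) := by
  rw [cube_eq_Icc]
  exact isCompact_Icc

theorem measurableSet_cube (N : ℕ) : MeasurableSet (cube N) :=
  (isCompact_cube N).measurableSet

theorem uniqueDiffOn_cube (N : ℕ) : UniqueDiffOn ℝ (cube N) := by
  rw [cube_eq_pi]
  exact UniqueDiffOn.univ_pi fun _ => uniqueDiffOn_Icc (by norm_num)

/-- The open cube `(-1,1)^N`. -/
def openCube (N : ℕ) : Set (Fin N → ℝ) :=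
  Set.univ.pi fun _ => Set.Ioo (-1 : ℝ) 1

theorem isOpen_openCube (N : ℕ) : IsOpen (openCube N) :=
  isOpen_set_pi Set.finite_univ fun _ _ => isOpen_Ioo

theorem openCube_subset_cube (N : ℕ) : openCube N ⊆ cube N :=
  fun _ hθ j => Set.Ioo_subset_Icc_self (hθ j trivial)

theorem cube_mem_nhds {θ : Fin N → ℝ} (hθ : θ ∈ openCube N) : cube N ∈ 𝓝 θ :=
  mem_of_superset ((isOpen_openCube N).mem_nhds hθ) (openCube_subset_cube N)

theorem integrableOn_cube {g : (Fin N → ℝ) → ℝ} (hg : ContinuousOn g (cube N)) :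
    IntegrableOn g (cube N) :=
  hg.integrableOn_compact (isCompact_cube N)

theorem setIntegral_cube_prod (F : Fin N → ℝ → ℝ) :
    ∫ θ in cube N, ∏ j, F j (θ j) = ∏ j, ∫ x in (-1 : ℝ)..1, F j x := by
  rw [cube_eq_pi, volume_pi, Measure.restrict_pi_pi, integral_fintype_prod_eq_prod]
  refine Finset.prod_congr rfl fun j _ => ?_
  rw [intervalIntegral.integral_of_le (by norm_num), integral_Icc_eq_integral_Ioc]

/-- The integral of a partial derivative `∂ⱼh` over the cube vanishes if `h` vanishes on the two
faces orthogonal to the `j`-th axis. -/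
theorem setIntegral_cube_fderiv_eq_zero (j : Fin N) (h : (Fin N → ℝ) → ℝ)
    (h' : (Fin N → ℝ) → (Fin N → ℝ) →L[ℝ] ℝ) (hc : ContinuousOn h (cube N))
    (hd : ∀ θ ∈ openCube N, HasFDerivAt h (h' θ) θ)
    (hi : IntegrableOn (fun θ => h' θ (Pi.single j 1)) (cube N))
    (hz : ∀ θ, θ j = 1 ∨ θ j = -1 → h θ = 0) :
    ∫ θ in cube N, h' θ (Pi.single j 1) = 0 := by
  classical
  cases N with
  | zero => exact j.elim0
  | succ n =>
    have e : ∀ θ, ∑ i, (if i = j then h' θ else 0) (Pi.single i 1) = h' θ (Pi.single j 1) := by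
      intro θ
      rw [Finset.sum_eq_single j]
      · simp
      · intro i _ hij; simp [hij]
      · simp
    -- Divergence theorem for the vector field whose only nonzero component is `h`, in direction
    -- `j`.
    have := integral_divergence_of_hasFDerivAt_off_countable' (fun _ : Fin (n + 1) => (-1 : ℝ))
      (fun _ => 1) (fun _ => by norm_num) (fun i => if i = j then h else 0)
      (fun i θ => if i = j then h' θ else 0) ∅ Set.countable_empty
      (by
        intro i
        rw [← cube_eq_Icc]
        split_ifs
        · exact hc
        · exact continuousOn_const)
      (by
        intro θ hθ i
        split_ifs
        · exact hd θ hθ.1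
        · exact hasFDerivAt_const 0 θ)
      (by
        rw [← cube_eq_Icc]
        simp only [e]
        exact hi)
    rw [← cube_eq_Icc] at this
    simp only [e] at this
    rw [this]
    refine Finset.sum_eq_zero fun i _ => ?_
    by_cases hij : i = j
    · subst hij
      simp [hz]
    · simp [hij]

end Cube

/-! ### Tensor Legendre functions and decay of the coefficients -/

section Tensor

variable {N : ℕ}

theorem continuous_normLegendre (n : ℕ) : Continuous (normLegendre n) := by
  unfold normLegendre
  fun_prop

theorem continuous_tensorLegendre (k : Fin N → ℕ) : Continuous (tensorLegendre k) := by
  unfold tensorLegendre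
  exact continuous_finsetProd _ fun j _ => (continuous_normLegendre _).comp (continuous_apply j)

theorem integral_normLegendre_mul (m n : ℕ) :
    ∫ x in (-1 : ℝ)..1, normLegendre m x * normLegendre n x = if m = n then 1 else 0 := by
  have e : ∀ x, normLegendre m x * normLegendre n x
      = (√(m + 1 / 2) * √(n + 1 / 2)) * (legendre m * legendre n).eval x := by
    intro x
    rw [normLegendre, normLegendre, Polynomial.eval_mul]
    ring
  simp only [e, intervalIntegral.integral_const_mul]
  split_ifs with h
  · subst h
    rw [integral_legendre_sq, Real.mul_self_sqrt (by positivity)]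
    field_simp
  · rw [integral_legendre_mul_legendre_of_ne h, mul_zero]

theorem integral_tensorLegendre_mul (k l : Fin N → ℕ) :
    ∫ θ in cube N, tensorLegendre k θ * tensorLegendre l θ = if k = l then 1 else 0 := by
  simp only [tensorLegendre, ← Finset.prod_mul_distrib]
  rw [setIntegral_cube_prod (fun j x => normLegendre (k j) x * normLegendre (l j) x)]
  simp only [integral_normLegendre_mul]
  split_ifs with h
  · subst h; simp
  · obtain ⟨j, hj⟩ := Function.ne_iff.1 h
    exact Finset.prod_eq_zero (Finset.mem_univ j) (by simp [hj])

theorem abs_normLegendre_le (n : ℕ) {x : ℝ} (hx : x ∈ Set.Icc (-1 : ℝ) 1) :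
    |normLegendre n x| ≤ √(n + 1) := by
  rw [normLegendre, abs_mul, abs_of_nonneg (Real.sqrt_nonneg _)]
  calc √(n + 1 / 2) * |(legendre n).eval x| ≤ √(n + 1 / 2) * 1 :=
        mul_le_mul_of_nonneg_left (abs_legendre_le_one n hx) (Real.sqrt_nonneg _)
    _ ≤ √(n + 1) := by
        rw [mul_one]
        exact Real.sqrt_le_sqrt (by linarith)

theorem abs_tensorLegendre_le (k : Fin N → ℕ) {θ : Fin N → ℝ} (hθ : θ ∈ cube N) :
    |tensorLegendre k θ| ≤ ∏ j, √(k j + 1) := by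
  rw [tensorLegendre, Finset.abs_prod]
  exact Finset.prod_le_prod (fun _ _ => abs_nonneg _) fun j _ => abs_normLegendre_le _ (hθ j)

/-- Pointwise `|ab| ≤ a² + b²` suffices: the tensor functions have norm one, so the bound does not
depend on `k`. -/
theorem exists_abs_coeff_le {g : (Fin N → ℝ) → ℝ} (hg : ContinuousOn g (cube N)) :
    ∃ C, 0 ≤ C ∧ ∀ k, |coeff g k| ≤ C := by
  have hg2 : 0 ≤ ∫ θ in cube N, g θ ^ 2 := integral_nonneg fun θ => sq_nonneg _
  refine ⟨(∫ θ in cube N, g θ ^ 2) + 1, by linarith, fun k => ?_⟩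
  have hT := continuous_tensorLegendre k
  have hi1 : IntegrableOn (fun θ => g θ ^ 2) (cube N) := integrableOn_cube (hg.pow 2)
  have hi2 : IntegrableOn (fun θ => tensorLegendre k θ * tensorLegendre k θ) (cube N) :=
    integrableOn_cube (hT.mul hT).continuousOn
  calc |coeff g k| ≤ ∫ θ in cube N, |g θ * tensorLegendre k θ| := abs_integral_le_integral_abs
    _ ≤ ∫ θ in cube N, (g θ ^ 2 + tensorLegendre k θ * tensorLegendre k θ) := by
        refine integral_mono (integrableOn_cube (hg.mul hT.continuousOn).abs) (hi1.add hi2)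
          fun θ => ?_
        rw [abs_mul]
        nlinarith [sq_nonneg (|g θ| - |tensorLegendre k θ|), sq_abs (g θ),
          sq_abs (tensorLegendre k θ), sq_nonneg (g θ), sq_nonneg (tensorLegendre k θ)]
    _ = (∫ θ in cube N, g θ ^ 2) + 1 := by
        rw [integral_add hi1 hi2, integral_tensorLegendre_mul, if_pos rfl]

/-- The product of all but the `j`-th factor of `tensorLegendre k`. -/
def tensorErase (j : Fin N) (k : Fin N → ℕ) (θ : Fin N → ℝ) : ℝ :=
  ∏ i ∈ Finset.univ.erase j, normLegendre (k i) (θ i)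

theorem tensorLegendre_update (j : Fin N) (k : Fin N → ℕ) (n : ℕ) (θ : Fin N → ℝ) :
    tensorLegendre (Function.update k j n) θ = normLegendre n (θ j) * tensorErase j k θ := by
  rw [tensorLegendre, ← Finset.mul_prod_erase _ _ (Finset.mem_univ j), Function.update_self,
    tensorErase]
  congr 1
  refine Finset.prod_congr rfl fun i hi => ?_
  rw [Function.update_of_ne (Finset.ne_of_mem_erase hi)]

theorem hasDerivAt_normLegendre (n : ℕ) (x : ℝ) :
    HasDerivAt (normLegendre n) (√(n + 1 / 2) * (legendre n).derivative.eval x) x :=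
  ((legendre n).hasDerivAt x).const_mul _

theorem differentiable_tensorErase (j : Fin N) (k : Fin N → ℕ) :
    Differentiable ℝ (tensorErase j k) := fun θ =>
  (HasFDerivAt.finsetProd (u := Finset.univ.erase j)
    (g := fun i (θ : Fin N → ℝ) => normLegendre (k i) (θ i)) fun i _ =>
      (hasDerivAt_normLegendre (k i) (θ i)).comp_hasFDerivAt (f := fun θ : Fin N → ℝ => θ i) θ
        (hasFDerivAt_apply (𝕜 := ℝ) (F' := fun _ : Fin N => ℝ) i θ)).differentiableAt

theorem fderiv_tensorErase_single (j : Fin N) (k : Fin N → ℕ) (θ : Fin N → ℝ) :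
    fderiv ℝ (tensorErase j k) θ (Pi.single j 1) = 0 := by
  have h := (differentiable_tensorErase j k θ).hasFDerivAt.hasLineDerivAt (Pi.single j 1)
  have hc : ∀ t : ℝ, tensorErase j k (θ + t • Pi.single j 1) = tensorErase j k θ := by
    intro t
    refine Finset.prod_congr rfl fun i hi => ?_
    simp [Finset.ne_of_mem_erase hi]
  unfold HasLineDerivAt at h
  simp only [hc] at h
  exact h.unique (hasDerivAt_const _ _)

/-- The `j`-th partial derivative of a function on the cube. -/
def cubePartial (j : Fin N) (g : (Fin N → ℝ) → ℝ) (θ : Fin N → ℝ) : ℝ :=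
  fderivWithin ℝ g (cube N) θ (Pi.single j 1)

theorem contDiffOn_cubePartial (j : Fin N) {g : (Fin N → ℝ) → ℝ} {s : ℕ}
    (hg : ContDiffOn ℝ ((s + 1 : ℕ) : WithTop ℕ∞) g (cube N)) :
    ContDiffOn ℝ (s : WithTop ℕ∞) (cubePartial j g) (cube N) :=
  (hg.fderivWithin (uniqueDiffOn_cube N) (by norm_cast)).clm_apply contDiffOn_const

/-- Integration by parts in the `j`-th variable. -/
theorem setIntegral_cube_by_parts (j : Fin N) {g : (Fin N → ℝ) → ℝ}
    (hg : ContDiffOn ℝ (1 : ℕ) g (cube N)) (k : Fin N → ℕ) (q : Polynomial ℝ)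
    (hq : q.eval 1 = 0) (hq' : q.eval (-1) = 0) :
    ∫ θ in cube N, g θ * (q.derivative.eval (θ j) * tensorErase j k θ)
      = - ∫ θ in cube N, cubePartial j g θ * (q.eval (θ j) * tensorErase j k θ) := by
  have hR := differentiable_tensorErase j k
  have hgc := hg.continuousOn
  have hDc : ContinuousOn (cubePartial j g) (cube N) :=
    (contDiffOn_cubePartial (s := 0) j hg).continuousOn
  have hqc : ∀ r : Polynomial ℝ, Continuous fun θ : Fin N → ℝ => r.eval (θ j) :=
    fun r => r.continuous.comp (continuous_apply j)
  have c1 : ContinuousOn (fun θ => g θ * (q.derivative.eval (θ j) * tensorErase j k θ))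
      (cube N) := hgc.mul ((hqc _).mul hR.continuous).continuousOn
  have c2 : ContinuousOn (fun θ => cubePartial j g θ * (q.eval (θ j) * tensorErase j k θ))
      (cube N) := hDc.mul ((hqc _).mul hR.continuous).continuousOn
  let h' : (Fin N → ℝ) → (Fin N → ℝ) →L[ℝ] ℝ := fun θ =>
    g θ • (q.eval (θ j) • fderiv ℝ (tensorErase j k) θ + tensorErase j k θ •
      (q.derivative.eval (θ j) • ContinuousLinearMap.proj (R := ℝ) (φ := fun _ : Fin N => ℝ) j))
      + (q.eval (θ j) * tensorErase j k θ) • fderivWithin ℝ g (cube N) θ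
  have e : ∀ θ, h' θ (Pi.single j 1) = g θ * (q.derivative.eval (θ j) * tensorErase j k θ)
      + cubePartial j g θ * (q.eval (θ j) * tensorErase j k θ) := by
    intro θ
    simp [h', fderiv_tensorErase_single, cubePartial]
    ring
  have := setIntegral_cube_fderiv_eq_zero j
    (fun θ => g θ * (q.eval (θ j) * tensorErase j k θ)) h'
    (hgc.mul ((hqc _).mul hR.continuous).continuousOn) ?_ ?_ ?_
  · simp only [e] at this
    rw [integral_add (integrableOn_cube c1) (integrableOn_cube c2)] at this
    linarith
  · intro θ hθ
    have hgd : HasFDerivAt g (fderivWithin ℝ g (cube N) θ) θ :=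
      ((hg.differentiableOn (by norm_num)) θ
        (openCube_subset_cube N hθ)).hasFDerivWithinAt.hasFDerivAt (cube_mem_nhds hθ)
    have hqd : HasFDerivAt (fun θ : Fin N → ℝ => q.eval (θ j)) (q.derivative.eval (θ j) •
        ContinuousLinearMap.proj (R := ℝ) (φ := fun _ : Fin N => ℝ) j) θ :=
      (q.hasDerivAt (θ j)).comp_hasFDerivAt (f := fun θ : Fin N → ℝ => θ j) θ
        (hasFDerivAt_apply (𝕜 := ℝ) (F' := fun _ : Fin N => ℝ) j θ)
    exact hgd.mul (hqd.mul (hR θ).hasFDerivAt)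
  · simp only [e]
    exact integrableOn_cube (c1.add c2)
  · rintro θ (h | h) <;> simp [h, hq, hq']

theorem coeff_update (j : Fin N) (g : (Fin N → ℝ) → ℝ) (k : Fin N → ℕ) (n : ℕ) :
    coeff g (Function.update k j n)
      = √(n + 1 / 2) * ∫ θ in cube N, g θ * ((legendre n).eval (θ j) * tensorErase j k θ) := by
  rw [coeff, ← integral_const_mul]
  congr 1
  ext θ
  rw [tensorLegendre_update, normLegendre]
  ring

/-- Integration by parts against `legendre (m + 2) - legendre m`, which vanishes at `±1` and has
derivative `(2m+3) legendre (m + 1)`. The factor 2 absorbs the ratio of the normalizations for `m +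
1` and `m`. -/
theorem abs_coeff_update_succ_le (j : Fin N) {g : (Fin N → ℝ) → ℝ}
    (hg : ContDiffOn ℝ (1 : ℕ) g (cube N)) (k : Fin N → ℕ) (m : ℕ) :
    (2 * m + 3) * |coeff g (Function.update k j (m + 1))|
      ≤ |coeff (cubePartial j g) (Function.update k j (m + 2))|
        + 2 * |coeff (cubePartial j g) (Function.update k j m)| := by
  have hp := setIntegral_cube_by_parts j hg k (legendre (m + 2) - legendre m)
    (by simp [legendre_eval_one]) (by simp [legendre_eval_neg_one, pow_add])
  have hDc : ContinuousOn (cubePartial j g) (cube N) :=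
    (contDiffOn_cubePartial (s := 0) j hg).continuousOn
  have hci : ∀ n, IntegrableOn
      (fun θ => cubePartial j g θ * ((legendre n).eval (θ j) * tensorErase j k θ)) (cube N) :=
    fun n => integrableOn_cube (hDc.mul (((legendre n).continuous.comp (continuous_apply j)).mul
      (differentiable_tensorErase j k).continuous).continuousOn)
  rw [derivative_legendre_sub] at hp
  have e1 : ∫ θ in cube N, g θ * (((2 * (m : Polynomial ℝ) + 3) * legendre (m + 1)).eval (θ j)
      * tensorErase j k θ)
      = (2 * m + 3) * ∫ θ in cube N, g θ * ((legendre (m + 1)).eval (θ j) * tensorErase j k θ) := by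
    rw [← integral_const_mul]
    congr 1
    ext θ
    simp
    ring
  have e2 : ∫ θ in cube N, cubePartial j g θ * ((legendre (m + 2) - legendre m).eval (θ j)
      * tensorErase j k θ)
      = (∫ θ in cube N, cubePartial j g θ * ((legendre (m + 2)).eval (θ j) * tensorErase j k θ))
      - ∫ θ in cube N, cubePartial j g θ * ((legendre m).eval (θ j) * tensorErase j k θ) := by
    rw [← integral_sub (hci _) (hci _)]
    congr 1
    ext θ
    simp
    ring
  rw [e1, e2] at hp
  rw [coeff_update, coeff_update, coeff_update]
  set A := ∫ θ in cube N, g θ * ((legendre (m + 1)).eval (θ j) * tensorErase j k θ)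
  set B := ∫ θ in cube N, cubePartial j g θ * ((legendre (m + 2)).eval (θ j) * tensorErase j k θ)
  set D := ∫ θ in cube N, cubePartial j g θ * ((legendre m).eval (θ j) * tensorErase j k θ)
  push_cast
  have s1 : √((m : ℝ) + 1 + 1 / 2) ≤ √((m : ℝ) + 2 + 1 / 2) := Real.sqrt_le_sqrt (by linarith)
  have s2 : √((m : ℝ) + 1 + 1 / 2) ≤ 2 * √((m : ℝ) + 1 / 2) := by
    have h4 : (2 : ℝ) = √4 := by
      rw [show (4 : ℝ) = 2 ^ 2 by norm_num, Real.sqrt_sq (by norm_num)]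
    rw [h4, ← Real.sqrt_mul (by norm_num)]
    refine Real.sqrt_le_sqrt ?_
    have : (0 : ℝ) ≤ m := Nat.cast_nonneg m
    linarith
  simp only [abs_mul, abs_of_nonneg (Real.sqrt_nonneg _)]
  have hA : (2 * m + 3) * |A| ≤ |B| + |D| := by
    have : |(2 * m + 3) * A| = |B - D| := by rw [hp, abs_neg]
    rw [abs_mul, abs_of_nonneg (by positivity)] at this
    rw [this]
    exact abs_sub B D
  calc (2 * m + 3) * (√((m : ℝ) + 1 + 1 / 2) * |A|)
      = √((m : ℝ) + 1 + 1 / 2) * ((2 * m + 3) * |A|) := by ring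
    _ ≤ √((m : ℝ) + 1 + 1 / 2) * (|B| + |D|) := by gcongr
    _ = √((m : ℝ) + 1 + 1 / 2) * |B| + √((m : ℝ) + 1 + 1 / 2) * |D| := by ring
    _ ≤ √((m : ℝ) + 2 + 1 / 2) * |B| + (2 * √((m : ℝ) + 1 / 2)) * |D| := by gcongr
    _ = _ := by ring

/-- The Legendre coefficients of a `C^s` function decay like `k_j ^ (-s)`. -/
theorem exists_abs_coeff_mul_pow_le (j : Fin N) (s : ℕ) (g : (Fin N → ℝ) → ℝ)
    (hg : ContDiffOn ℝ (s : WithTop ℕ∞) g (cube N)) :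
    ∃ C, 0 ≤ C ∧ ∀ k : Fin N → ℕ, |coeff g k| * ((k j : ℝ) + 1) ^ s ≤ C := by
  induction s generalizing g with
  | zero => simpa using exists_abs_coeff_le hg.continuousOn
  | succ s ih =>
    obtain ⟨C, hC, h⟩ := ih _ (contDiffOn_cubePartial j hg)
    obtain ⟨C₀, hC₀, h₀⟩ := exists_abs_coeff_le hg.continuousOn
    -- `C₀` covers `k j = 0`. Otherwise the neighbours `m + 2` and `m` contribute `C` and `2 * 2 ^ s
    -- * C`, the power of two coming from `m + 2 ≤ 2 (m + 1)`.
    refine ⟨C₀ + (1 + 2 * 2 ^ s) * C, by positivity, fun k => ?_⟩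
    rcases hk : k j with _ | m
    · simp only [Nat.cast_zero, zero_add, one_pow, mul_one]
      have : 0 ≤ (1 + 2 * 2 ^ s) * C := by positivity
      linarith [h₀ k]
    · have h1 := abs_coeff_update_succ_le j (hg.of_le (by norm_cast; omega)) k m
      rw [← hk, Function.update_eq_self] at h1
      have h2 := h (Function.update k j (m + 2))
      have h3 := h (Function.update k j m)
      rw [Function.update_self] at h2 h3
      set a := |coeff g k|
      set b := |coeff (cubePartial j g) (Function.update k j (m + 2))|
      set d := |coeff (cubePartial j g) (Function.update k j m)|
      have hb : b * ((m : ℝ) + 2) ^ s ≤ C := by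
        refine le_trans ?_ h2
        push_cast
        have : (m : ℝ) + 2 ≤ m + 2 + 1 := by linarith
        exact mul_le_mul_of_nonneg_left (pow_le_pow_left₀ (by positivity) this _) (abs_nonneg _)
      have hd : d * ((m : ℝ) + 2) ^ s ≤ 2 ^ s * C := by
        calc d * ((m : ℝ) + 2) ^ s ≤ d * (2 * ((m : ℝ) + 1)) ^ s := by
              have : 0 ≤ d := abs_nonneg _
              gcongr
              have : (0 : ℝ) ≤ m := Nat.cast_nonneg m
              linarith
          _ = 2 ^ s * (d * ((m : ℝ) + 1) ^ s) := by rw [mul_pow]; ring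
          _ ≤ 2 ^ s * C := by gcongr
      have ha : 0 ≤ a := abs_nonneg _
      have hm : (0 : ℝ) ≤ m := Nat.cast_nonneg m
      calc a * (((m + 1 : ℕ) : ℝ) + 1) ^ (s + 1)
          = (((m : ℝ) + 2) * a) * ((m : ℝ) + 2) ^ s := by push_cast; ring
        _ ≤ (b + 2 * d) * ((m : ℝ) + 2) ^ s := by
            gcongr
            exact (mul_le_mul_of_nonneg_right (by linarith) ha).trans h1
        _ ≤ C + 2 * (2 ^ s * C) := by linarith
        _ ≤ _ := by linarith

end Tensor

/-! ### Summable majorants for the series and its derivative -/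

section Summability

variable {N : ℕ}

/-- Every finite set of multi-indices lies in a box, over which the sum factors. -/
theorem summable_pi_prod {a : ℕ → ℝ} (ha : ∀ n, 0 ≤ a n) (hs : Summable a) :
    Summable fun k : Fin N → ℕ => ∏ j, a (k j) := by
  classical
  refine summable_of_sum_le (c := (∑' n, a n) ^ N)
    (fun k => Finset.prod_nonneg fun j _ => ha _) fun u => ?_
  let v : Fin N → Finset ℕ := fun j => u.image fun k => k j
  calc ∑ k ∈ u, ∏ j, a (k j) ≤ ∑ k ∈ Fintype.piFinset v, ∏ j, a (k j) := by
        refine Finset.sum_le_sum_of_subset_of_nonneg (fun k hk => ?_)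
          fun k _ _ => Finset.prod_nonneg fun j _ => ha _
        exact Fintype.mem_piFinset.2 fun j => Finset.mem_image_of_mem _ hk
    _ = ∏ j, ∑ n ∈ v j, a n := (Finset.prod_univ_sum v fun _ n => a n).symm
    _ ≤ ∏ _j : Fin N, ∑' n, a n :=
        Finset.prod_le_prod (fun j _ => Finset.sum_nonneg fun n _ => ha n)
          fun j _ => hs.sum_le_tsum _ fun n _ => ha n
    _ = (∑' n, a n) ^ N := by simp

/-- A summable product weight on multi-indices. -/
def weight (k : Fin N → ℕ) : ℝ :=
  ∏ j, (((k j : ℝ) + 1) ^ (1 + 1 / (N : ℝ)))⁻¹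

theorem summable_weight (hN : 0 < N) : Summable (weight (N := N)) := by
  refine summable_pi_prod (a := fun n => (((n : ℝ) + 1) ^ (1 + 1 / (N : ℝ)))⁻¹)
    (fun n => by positivity) ?_
  have h : Summable fun n : ℕ => ((n : ℝ) ^ (1 + 1 / (N : ℝ)))⁻¹ :=
    Real.summable_nat_rpow_inv.2 (by
      have : (0 : ℝ) < N := by exact_mod_cast hN
      have : 0 < 1 / (N : ℝ) := by positivity
      linarith)
  have := (summable_nat_add_iff 1).2 h
  simpa using this

/-- With `b` the largest `k j + 1`, the square roots cost `b ^ (N/2)`, the factor `k i + 1` costs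
`b`, and dividing by `weight k` costs `b ^ (N + 1)` because of its exponent `1 + 1/N`. The decay `b
^ (-s)` in the direction of the largest index pays for all three. -/
theorem exists_abs_coeff_mul_le_weight (hN : 0 < N) {s : ℕ} (hs : (3 / 2 : ℝ) * N + 2 ≤ s)
    {g : (Fin N → ℝ) → ℝ} (hg : ContDiffOn ℝ (s : WithTop ℕ∞) g (cube N)) :
    ∃ C, 0 ≤ C ∧ ∀ (k : Fin N → ℕ) (i : Fin N),
      |coeff g k| * ((∏ j, √((k j : ℝ) + 1)) * (k i + 1)) ≤ C * weight k := by
  choose C hC h using fun j => exists_abs_coeff_mul_pow_le j s g hg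
  have : Nonempty (Fin N) := ⟨⟨0, hN⟩⟩
  have hN' : (0 : ℝ) < N := by exact_mod_cast hN
  refine ⟨∑ j, C j, Finset.sum_nonneg fun j _ => hC j, fun k i => ?_⟩
  obtain ⟨m, hm⟩ := Finite.exists_max k
  have hkm : ∀ j, (k j : ℝ) + 1 ≤ k m + 1 := fun j => by
    have : (k j : ℝ) ≤ k m := by exact_mod_cast hm j
    linarith
  set b : ℝ := (k m : ℝ) + 1 with hb
  have hb1 : 1 ≤ b := by
    have : (0 : ℝ) ≤ k m := Nat.cast_nonneg _
    linarith
  have hb0 : 0 < b := by linarith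
  have hCm : C m ≤ ∑ j, C j := Finset.single_le_sum (fun j _ => hC j) (Finset.mem_univ m)
  have e1 : ∏ j, √((k j : ℝ) + 1) ≤ b ^ ((N : ℝ) / 2) := by
    calc ∏ j, √((k j : ℝ) + 1) ≤ ∏ _j : Fin N, √b :=
          Finset.prod_le_prod (fun _ _ => Real.sqrt_nonneg _) fun j _ => Real.sqrt_le_sqrt (hkm j)
      _ = b ^ ((N : ℝ) / 2) := by
          rw [Finset.prod_const, Finset.card_univ, Fintype.card_fin, Real.sqrt_eq_rpow,
            ← Real.rpow_natCast, ← Real.rpow_mul hb0.le]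
          congr 1
          ring
  have e2 : ∏ j, (((k j : ℝ) + 1) ^ (1 + 1 / (N : ℝ))) ≤ b ^ ((N : ℝ) + 1) := by
    calc ∏ j, (((k j : ℝ) + 1) ^ (1 + 1 / (N : ℝ))) ≤ ∏ _j : Fin N, b ^ (1 + 1 / (N : ℝ)) :=
          Finset.prod_le_prod (fun _ _ => by positivity) fun j _ =>
            Real.rpow_le_rpow (by positivity) (hkm j) (by positivity)
      _ = b ^ ((N : ℝ) + 1) := by
          rw [Finset.prod_const, Finset.card_univ, Fintype.card_fin,
            ← Real.rpow_natCast, ← Real.rpow_mul hb0.le]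
          congr 1
          field_simp
  rw [weight, Finset.prod_inv_distrib, ← div_eq_mul_inv, le_div_iff₀ (by positivity)]
  calc |coeff g k| * ((∏ j, √((k j : ℝ) + 1)) * (k i + 1))
        * ∏ j, (((k j : ℝ) + 1) ^ (1 + 1 / (N : ℝ)))
      ≤ |coeff g k| * (b ^ ((N : ℝ) / 2) * b) * b ^ ((N : ℝ) + 1) := by
        gcongr
        exact hkm i
    _ = |coeff g k| * b ^ ((3 / 2 : ℝ) * N + 2) := by
        nth_rewrite 2 [← Real.rpow_one b]
        rw [mul_assoc, ← Real.rpow_add hb0, ← Real.rpow_add hb0]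
        congr 2
        ring
    _ ≤ |coeff g k| * b ^ (s : ℝ) := by
        gcongr
    _ = |coeff g k| * b ^ s := by rw [Real.rpow_natCast]
    _ ≤ C m := h m k
    _ ≤ _ := hCm

/-- The Fréchet derivative of `tensorLegendre k`. -/
def tensorLegendreDeriv (k : Fin N → ℕ) (θ : Fin N → ℝ) : (Fin N → ℝ) →L[ℝ] ℝ :=
  ∑ i, tensorErase i k θ • ((√(k i + 1 / 2) * (legendre (k i)).derivative.eval (θ i)) •
    ContinuousLinearMap.proj (R := ℝ) (φ := fun _ : Fin N => ℝ) i)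

theorem hasFDerivAt_tensorLegendre (k : Fin N → ℕ) (θ : Fin N → ℝ) :
    HasFDerivAt (tensorLegendre k) (tensorLegendreDeriv k θ) θ :=
  HasFDerivAt.finsetProd (u := Finset.univ) (g := fun i (θ : Fin N → ℝ) => normLegendre (k i) (θ i))
    fun i _ => (hasDerivAt_normLegendre (k i) (θ i)).comp_hasFDerivAt
      (f := fun θ : Fin N → ℝ => θ i) θ
        (hasFDerivAt_apply (𝕜 := ℝ) (F' := fun _ : Fin N => ℝ) i θ)

theorem norm_tensorLegendreDeriv_le (k : Fin N → ℕ) {θ : Fin N → ℝ} {ρ : ℝ} (hρ : 0 ≤ ρ)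
    (hρ1 : ρ < 1) (hθ : ∀ j, |θ j| ≤ ρ) :
    ‖tensorLegendreDeriv k θ‖
      ≤ ∑ i, ((∏ j, √((k j : ℝ) + 1)) * (k i + 1)) / √(1 - ρ ^ 2) := by
  refine norm_sum_le_of_le _ fun i _ => ?_
  have hθ' : ∀ j, θ j ∈ Set.Icc (-1 : ℝ) 1 := fun j => abs_le.1 ((hθ j).trans hρ1.le)
  have h1 : ‖ContinuousLinearMap.proj (R := ℝ) (φ := fun _ : Fin N => ℝ) i‖ ≤ 1 :=
    ContinuousLinearMap.opNorm_le_bound _ zero_le_one fun x => by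
      simpa using norm_le_pi_norm x i
  have h2 : |tensorErase i k θ| ≤ ∏ j ∈ Finset.univ.erase i, √((k j : ℝ) + 1) := by
    rw [tensorErase, Finset.abs_prod]
    exact Finset.prod_le_prod (fun _ _ => abs_nonneg _) fun j _ => abs_normLegendre_le _ (hθ' j)
  have h3 := abs_derivative_legendre_le (k i) hρ hρ1 (hθ i)
  have h4 : √((k i : ℝ) + 1 / 2) ≤ √((k i : ℝ) + 1) := Real.sqrt_le_sqrt (by linarith)
  rw [norm_smul, norm_smul, Real.norm_eq_abs, Real.norm_eq_abs, abs_mul,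
    abs_of_nonneg (Real.sqrt_nonneg _), ← Finset.mul_prod_erase _ _ (Finset.mem_univ i)]
  calc |tensorErase i k θ| * (√((k i : ℝ) + 1 / 2) * |(legendre (k i)).derivative.eval (θ i)|
        * ‖ContinuousLinearMap.proj (R := ℝ) (φ := fun _ : Fin N => ℝ) i‖)
      ≤ (∏ j ∈ Finset.univ.erase i, √((k j : ℝ) + 1))
        * (√((k i : ℝ) + 1) * ((k i + 1) / √(1 - ρ ^ 2)) * 1) := by gcongr
    _ = _ := by ring

end Summability

/-! ### Completeness of the tensor Legendre system -/

section Completeness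

variable {N : ℕ}

theorem exists_mul_normLegendre_eq (n : ℕ) :
    ∃ a b : ℝ, ∀ x, x * normLegendre n x
      = a * normLegendre (n + 1) x + b * normLegendre (n - 1) x := by
  have hp : ∀ n x, (legendre n).eval x = (√(n + 1 / 2))⁻¹ * normLegendre n x := fun n x => by
    rw [normLegendre, inv_mul_cancel_left₀ (by positivity)]
  cases n with
  | zero =>
    -- For index 0 the truncated `n - 1` is again 0; this is harmless because `b = 0`.
    refine ⟨√(0 + 1 / 2) * (√((1 : ℕ) + 1 / 2))⁻¹, 0, fun x => ?_⟩
    rw [mul_assoc, zero_add, ← hp]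
    simp [normLegendre, legendre, mul_comm]
  | succ n =>
    refine ⟨√((n + 1 : ℕ) + 1 / 2) * ((2 * n + 3 : ℝ)⁻¹ * (n + 2) * (√((n + 2 : ℕ) + 1 / 2))⁻¹),
      √((n + 1 : ℕ) + 1 / 2) * ((2 * n + 3 : ℝ)⁻¹ * (n + 1) * (√(n + 1 / 2))⁻¹), fun x => ?_⟩
    have h := congrArg (Polynomial.eval x) (legendre_rec n)
    simp at h
    have h' : x * (legendre (n + 1)).eval x = (2 * n + 3 : ℝ)⁻¹ * ((n + 2) *
        (legendre (n + 2)).eval x + (n + 1) * (legendre n).eval x) := by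
      rw [eq_inv_mul_iff_mul_eq₀ (by positivity)]
      linarith
    rw [hp (n + 2), hp n] at h'
    rw [normLegendre, mul_left_comm, h', Nat.add_sub_cancel]
    ring

/-- Multiplication by `X j` shifts `k j` by one in either direction, by the three-term recurrence;
hence the induction on `p` must keep `k` arbitrary. -/
theorem integral_mul_mvPolynomial_mul_tensorLegendre {h : (Fin N → ℝ) → ℝ}
    (hc : ContinuousOn h (cube N)) (h0 : ∀ k, coeff h k = 0) (p : MvPolynomial (Fin N) ℝ)
    (k : Fin N → ℕ) :
    ∫ θ in cube N, h θ * (MvPolynomial.eval θ p * tensorLegendre k θ) = 0 := by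
  have hi : ∀ (p : MvPolynomial (Fin N) ℝ) (k : Fin N → ℕ), IntegrableOn
      (fun θ => h θ * (MvPolynomial.eval θ p * tensorLegendre k θ)) (cube N) := fun p k =>
    integrableOn_cube (hc.mul ((MvPolynomial.continuous_eval p).mul
      (continuous_tensorLegendre k)).continuousOn)
  induction p using MvPolynomial.induction_on generalizing k with
  | C a =>
    have : ∀ θ, h θ * (MvPolynomial.eval θ (MvPolynomial.C a) * tensorLegendre k θ)
        = a * (h θ * tensorLegendre k θ) := fun θ => by
      rw [MvPolynomial.eval_C]; ring
    simp only [this, integral_const_mul]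
    rw [← coeff, h0, mul_zero]
  | add p q hp hq =>
    simp only [map_add, add_mul, mul_add]
    rw [integral_add (hi p k) (hi q k), hp, hq, add_zero]
  | mul_X p j hp =>
    obtain ⟨a, b, hab⟩ := exists_mul_normLegendre_eq (k j)
    have : ∀ θ, h θ * (MvPolynomial.eval θ (p * MvPolynomial.X j) * tensorLegendre k θ)
        = a * (h θ * (MvPolynomial.eval θ p
            * tensorLegendre (Function.update k j (k j + 1)) θ))
        + b * (h θ * (MvPolynomial.eval θ p
            * tensorLegendre (Function.update k j (k j - 1)) θ)) := by
      intro θ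
      have e : tensorLegendre k θ = normLegendre (k j) (θ j) * tensorErase j k θ := by
        rw [← tensorLegendre_update, Function.update_eq_self]
      rw [e, tensorLegendre_update, tensorLegendre_update, map_mul, MvPolynomial.eval_X]
      linear_combination h θ * MvPolynomial.eval θ p * tensorErase j k θ * hab (θ j)
    simp only [this]
    rw [integral_add ((hi _ _).const_mul a) ((hi _ _).const_mul b), integral_const_mul,
      integral_const_mul, hp, hp, mul_zero, mul_zero, add_zero]

/-- Stone–Weierstrass: the coordinate functions separate the points of the compact cube. -/
theorem exists_mvPolynomial_near {h : (Fin N → ℝ) → ℝ} (hc : ContinuousOn h (cube N)) {ε : ℝ}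
    (hε : 0 < ε) :
    ∃ p : MvPolynomial (Fin N) ℝ, ∀ θ ∈ cube N, |MvPolynomial.eval θ p - h θ| < ε := by
  have : CompactSpace (cube N) := isCompact_iff_compactSpace.1 (isCompact_cube N)
  let x : Fin N → C(cube N, ℝ) := fun j =>
    ⟨fun θ => θ.1 j, (continuous_apply j).comp continuous_subtype_val⟩
  let Φ := MvPolynomial.aeval (R := ℝ) x
  have hΦ : ∀ p (θ : cube N), Φ p θ = MvPolynomial.eval θ.1 p := by
    intro p θ
    induction p using MvPolynomial.induction_on with
    | C a => simp [Φ]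
    | add p q hp hq => simp [hp, hq]
    | mul_X p j hp =>
      rw [map_mul, ContinuousMap.mul_apply, hp, map_mul, MvPolynomial.eval_X]
      simp [Φ, x]
  have hsep : Φ.range.SeparatesPoints := by
    intro θ η hne
    obtain ⟨j, hj⟩ := Function.ne_iff.1 (Subtype.coe_ne_coe.2 hne)
    exact ⟨x j, ⟨x j, ⟨MvPolynomial.X j, by simp [Φ]⟩, rfl⟩, hj⟩
  obtain ⟨⟨_, p, rfl⟩, hp⟩ :=
    ContinuousMap.exists_mem_subalgebra_near_continuous_of_separatesPoints Φ.range hsep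
      ((cube N).domRestrict h) hc.domRestrict ε hε
  refine ⟨p, fun θ hθ => ?_⟩
  have := hp ⟨θ, hθ⟩
  rw [Real.norm_eq_abs] at this
  rw [← hΦ p ⟨θ, hθ⟩]
  exact this

/-- Completeness of the tensor Legendre system: a continuous function with vanishing coefficients
vanishes on the open cube. -/
theorem eqOn_zero_of_coeff_eq_zero {h : (Fin N → ℝ) → ℝ} (hc : ContinuousOn h (cube N))
    (h0 : ∀ k, coeff h k = 0) : Set.EqOn h 0 (openCube N) := by
  have hT : ∀ θ : Fin N → ℝ, tensorLegendre (0 : Fin N → ℕ) θ = √(1 / 2) ^ N := fun θ => by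
    simp [tensorLegendre, normLegendre, legendre]
  have hp0 : ∀ p : MvPolynomial (Fin N) ℝ,
      ∫ θ in cube N, h θ * MvPolynomial.eval θ p = 0 := by
    intro p
    have := integral_mul_mvPolynomial_mul_tensorLegendre hc h0 p 0
    simp only [hT, ← mul_assoc, integral_mul_const] at this
    exact (mul_eq_zero.1 this).resolve_right (by positivity)
  have hia : IntegrableOn (fun θ => |h θ|) (cube N) := integrableOn_cube hc.abs
  have hi2 : IntegrableOn (fun θ => h θ * h θ) (cube N) := integrableOn_cube (hc.mul hc)
  -- Since `h` is orthogonal to every polynomial `p`, `∫ h² = ∫ h (h - p) ≤ sup |h - p| * ∫ |h|`,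
  -- which is arbitrarily small.
  have hsq : ∫ θ in cube N, h θ * h θ = 0 := by
    refine le_antisymm (le_of_forall_pos_le_add fun ε hε => ?_)
      (integral_nonneg fun θ => mul_self_nonneg _)
    set I := ∫ θ in cube N, |h θ|
    have hI : 0 ≤ I := integral_nonneg fun θ => abs_nonneg _
    obtain ⟨p, hp⟩ := exists_mvPolynomial_near hc (ε := ε / (I + 1)) (by positivity)
    have hip : IntegrableOn (fun θ => h θ * MvPolynomial.eval θ p) (cube N) :=
      integrableOn_cube (hc.mul (MvPolynomial.continuous_eval p).continuousOn)
    calc ∫ θ in cube N, h θ * h θ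
        = ∫ θ in cube N, (h θ * h θ - h θ * MvPolynomial.eval θ p) := by
          rw [integral_sub hi2 hip, hp0, sub_zero]
      _ ≤ ∫ θ in cube N, ε / (I + 1) * |h θ| := by
          refine setIntegral_mono_on (hi2.sub hip) (hia.const_mul _) (measurableSet_cube N)
            fun θ hθ => ?_
          rw [← mul_sub]
          refine (le_abs_self _).trans ?_
          rw [abs_mul, mul_comm, abs_sub_comm]
          exact mul_le_mul_of_nonneg_right (hp θ hθ).le (abs_nonneg _)
      _ = ε / (I + 1) * I := integral_const_mul _ _
      _ ≤ 0 + ε := by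
          rw [div_mul_eq_mul_div, div_le_iff₀ (by positivity)]
          nlinarith
  rw [integral_eq_zero_iff_of_nonneg (fun θ => mul_self_nonneg _) hi2] at hsq
  refine Measure.eqOn_open_of_ae_eq (μ := volume) ?_ (isOpen_openCube N)
    (hc.mono (openCube_subset_cube N)) continuousOn_const
  have := ae_restrict_of_ae_restrict_of_subset (openCube_subset_cube N) hsq
  filter_upwards [this] with θ hθ
  exact mul_self_eq_zero.1 hθ

/-- A Legendre series that converges absolutely and uniformly represents the function. -/
theorem tsum_coeff_mul_tensorLegendre {g : (Fin N → ℝ) → ℝ} (hg : ContinuousOn g (cube N))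
    {u : (Fin N → ℕ) → ℝ} (hu : Summable u)
    (hgu : ∀ k, ∀ θ ∈ cube N, |coeff g k * tensorLegendre k θ| ≤ u k) {θ : Fin N → ℝ}
    (hθ : θ ∈ openCube N) : ∑' k, coeff g k * tensorLegendre k θ = g θ := by
  set G : (Fin N → ℝ) → ℝ := fun θ => ∑' k, coeff g k * tensorLegendre k θ with hG
  have hGc : ContinuousOn G (cube N) :=
    continuousOn_tsum (fun k => (continuous_const.mul (continuous_tensorLegendre k)).continuousOn)
      hu hgu
  -- Integrating the series term by term against `tensorLegendre l` leaves one term, by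
  -- orthonormality; completeness then applies to `G - g`.
  have hcoeff : ∀ l, coeff G l = coeff g l := by
    intro l
    have hs : HasSum (fun k => ∫ θ in cube N, coeff g k * tensorLegendre k θ * tensorLegendre l θ)
        (∫ θ in cube N, G θ * tensorLegendre l θ) := by
      refine hasSum_integral_of_dominated_convergence (μ := volume.restrict (cube N))
        (fun k _ => u k * ∏ j, √((l j : ℝ) + 1)) (fun k => ?_) (fun k => ?_) ?_ ?_ ?_
      · exact ((continuous_const.mul (continuous_tensorLegendre k)).mul
          (continuous_tensorLegendre l)).aestronglyMeasurable
      · filter_upwards [ae_restrict_mem (measurableSet_cube N)] with θ hθ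
        rw [Real.norm_eq_abs, abs_mul]
        exact mul_le_mul (hgu k θ hθ) (abs_tensorLegendre_le l hθ) (abs_nonneg _)
          ((abs_nonneg _).trans (hgu k θ hθ))
      · exact Eventually.of_forall fun _ => hu.mul_right _
      · exact integrableOn_cube (g := fun _ => ∑' k, u k * ∏ j, √((l j : ℝ) + 1))
          continuousOn_const
      · filter_upwards [ae_restrict_mem (measurableSet_cube N)] with θ hθ
        have hsum : Summable fun k => coeff g k * tensorLegendre k θ :=
          Summable.of_norm_bounded hu fun k => hgu k θ hθ
        exact hsum.hasSum.mul_right (tensorLegendre l θ)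
    have e : ∀ k, ∫ θ in cube N, coeff g k * tensorLegendre k θ * tensorLegendre l θ
        = if k = l then coeff g l else 0 := by
      intro k
      simp only [mul_assoc, integral_const_mul, integral_tensorLegendre_mul]
      split_ifs with h
      · rw [h, mul_one]
      · rw [mul_zero]
    simp only [e] at hs
    exact hs.unique (hasSum_ite_eq l (coeff g l))
  have h0 : ∀ k, coeff (fun θ => G θ - g θ) k = 0 := by
    intro k
    have hT := (continuous_tensorLegendre k).continuousOn (s := cube N)
    have i1 : IntegrableOn (fun θ => G θ * tensorLegendre k θ) (cube N) :=
      integrableOn_cube (hGc.mul hT)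
    have i2 : IntegrableOn (fun θ => g θ * tensorLegendre k θ) (cube N) :=
      integrableOn_cube (hg.mul hT)
    rw [coeff]
    simp only [sub_mul]
    rw [integral_sub i1 i2, ← coeff, ← coeff, hcoeff, sub_self]
  exact sub_eq_zero.1 (eqOn_zero_of_coeff_eq_zero (hGc.sub hg) h0 hθ)

end Completeness

/-! ### `C¹` convergence of the surrogates inside the cube -/

section Convergence

variable {N : ℕ}

/-- The boxes exhaust the multi-indices, so unconditional summability gives convergence of the
surrogates. -/
theorem tendsto_multiIndices (N : ℕ) : Tendsto (multiIndices N) atTop atTop := by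
  refine tendsto_atTop_finset_of_monotone (fun M M' h => ?_) fun k => ?_
  · exact Fintype.piFinset_subset _ _ fun _ => Finset.range_mono (by omega)
  · refine ⟨∑ j, k j, Fintype.mem_piFinset.2 fun j => Finset.mem_range.2 ?_⟩
    exact Nat.lt_succ_of_le (Finset.single_le_sum (fun _ _ => Nat.zero_le _) (Finset.mem_univ j))

/-- The Fréchet derivative of `surrogate M g`. -/
def surrogateDeriv (M : ℕ) (g : (Fin N → ℝ) → ℝ) (θ : Fin N → ℝ) : (Fin N → ℝ) →L[ℝ] ℝ :=
  ∑ k ∈ multiIndices N M, coeff g k • tensorLegendreDeriv k θ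

theorem hasFDerivAt_surrogate (M : ℕ) (g : (Fin N → ℝ) → ℝ) (θ : Fin N → ℝ) :
    HasFDerivAt (surrogate M g) (surrogateDeriv M g θ) θ :=
  HasFDerivAt.fun_sum fun k _ => (hasFDerivAt_tensorLegendre k θ).const_mul (coeff g k)

theorem continuous_surrogate (M : ℕ) (g : (Fin N → ℝ) → ℝ) : Continuous (surrogate M g) :=
  continuous_iff_continuousAt.2 fun θ => (hasFDerivAt_surrogate M g θ).continuousAt

variable {s : ℕ} {g : (Fin N → ℝ) → ℝ}

theorem exists_summable_bound (hN : 0 < N) (hs : (3 / 2 : ℝ) * N + 2 ≤ s)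
    (hg : ContDiffOn ℝ (s : WithTop ℕ∞) g (cube N)) :
    ∃ u : (Fin N → ℕ) → ℝ, Summable u ∧
      ∀ k, ∀ θ ∈ cube N, |coeff g k * tensorLegendre k θ| ≤ u k := by
  obtain ⟨C, hC, h⟩ := exists_abs_coeff_mul_le_weight hN hs hg
  refine ⟨fun k => C * weight k, (summable_weight hN).mul_left C, fun k θ hθ => ?_⟩
  refine le_trans ?_ (h k ⟨0, hN⟩)
  rw [abs_mul]
  refine mul_le_mul_of_nonneg_left ((abs_tensorLegendre_le k hθ).trans ?_) (abs_nonneg _)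
  exact le_mul_of_one_le_right (by positivity) (by simp)

theorem exists_summable_bound_deriv (hN : 0 < N) (hs : (3 / 2 : ℝ) * N + 2 ≤ s)
    (hg : ContDiffOn ℝ (s : WithTop ℕ∞) g (cube N)) {ρ : ℝ} (hρ : 0 ≤ ρ) (hρ1 : ρ < 1) :
    ∃ u : (Fin N → ℕ) → ℝ, Summable u ∧ ∀ k (θ : Fin N → ℝ), (∀ j, |θ j| ≤ ρ) →
      ‖coeff g k • tensorLegendreDeriv k θ‖ ≤ u k := by
  obtain ⟨C, hC, h⟩ := exists_abs_coeff_mul_le_weight hN hs hg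
  refine ⟨fun k => ∑ _i : Fin N, C * weight k / √(1 - ρ ^ 2),
    summable_sum fun _ _ => ((summable_weight hN).mul_left C).div_const _, fun k θ hθ => ?_⟩
  rw [norm_smul, Real.norm_eq_abs]
  refine (mul_le_mul_of_nonneg_left (norm_tensorLegendreDeriv_le k hρ hρ1 hθ)
    (abs_nonneg _)).trans ?_
  rw [Finset.mul_sum]
  refine Finset.sum_le_sum fun i _ => ?_
  rw [← mul_div_assoc]
  exact div_le_div_of_nonneg_right (h k i) (Real.sqrt_nonneg _)

theorem tendsto_surrogate (hN : 0 < N) (hs : (3 / 2 : ℝ) * N + 2 ≤ s)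
    (hg : ContDiffOn ℝ (s : WithTop ℕ∞) g (cube N)) {θ : Fin N → ℝ} (hθ : θ ∈ openCube N) :
    Tendsto (fun M => surrogate M g θ) atTop (𝓝 (g θ)) := by
  obtain ⟨u, hu, hgu⟩ := exists_summable_bound hN hs hg
  rw [← tsum_coeff_mul_tensorLegendre hg.continuousOn hu hgu hθ]
  have hsum : Summable fun k => coeff g k * tensorLegendre k θ :=
    Summable.of_norm_bounded hu fun k => hgu k θ (openCube_subset_cube N hθ)
  exact hsum.hasSum.comp (tendsto_multiIndices N)

theorem exists_radius {θ : Fin N → ℝ} (hθ : θ ∈ openCube N) :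
    ∃ ρ : ℝ, 0 < ρ ∧ ρ < 1 ∧ ∀ j, |θ j| < ρ := by
  have h1 : ‖θ‖ < 1 := (pi_norm_lt_iff zero_lt_one).2 fun j => abs_lt.2 (hθ j trivial)
  obtain ⟨ρ, h, h'⟩ := exists_between h1
  exact ⟨ρ, (norm_nonneg θ).trans_lt h, h', fun j => (norm_le_pi_norm θ j).trans_lt h⟩

/-- The derivatives of the surrogates converge, locally uniformly in the open cube. -/
theorem tendsto_surrogateDeriv (hN : 0 < N) (hs : (3 / 2 : ℝ) * N + 2 ≤ s)
    (hg : ContDiffOn ℝ (s : WithTop ℕ∞) g (cube N)) {θ : Fin N → ℝ} (hθ : θ ∈ openCube N) :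
    Tendsto (fun p : ℕ × (Fin N → ℝ) => surrogateDeriv p.1 g p.2) (atTop ×ˢ 𝓝 θ)
      (𝓝 (fderiv ℝ g θ)) := by
  obtain ⟨ρ, hρ, hρ1, hθρ⟩ := exists_radius hθ
  let B : Set (Fin N → ℝ) := Set.univ.pi fun _ => Set.Ioo (-ρ) ρ
  have hB : IsOpen B := isOpen_set_pi Set.finite_univ fun _ _ => isOpen_Ioo
  have hθB : θ ∈ B := fun j _ => abs_lt.1 (hθρ j)
  have hBρ : ∀ η ∈ B, ∀ j, |η j| ≤ ρ := fun η hη j => (abs_lt.2 (hη j trivial)).le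
  have hBcube : B ⊆ openCube N := fun η hη j _ => abs_lt.1 ((hBρ η hη j).trans_lt hρ1)
  obtain ⟨u, hu, hgu⟩ := exists_summable_bound hN hs hg
  obtain ⟨v, hv, hgv⟩ := exists_summable_bound_deriv hN hs hg hρ.le hρ1
  -- Termwise differentiation on the convex open box `B`, where the differentiated series has a
  -- summable majorant.
  have hd : ∀ η ∈ B, fderiv ℝ g η = ∑' k, coeff g k • tensorLegendreDeriv k η := by
    intro η hη
    have h := hasFDerivAt_tsum_of_isPreconnected (𝕜 := ℝ)
      (f := fun k θ => coeff g k * tensorLegendre k θ)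
      (f' := fun k θ => coeff g k • tensorLegendreDeriv k θ) hv hB
      (convex_pi fun _ _ => convex_Ioo _ _).isPreconnected
      (fun k η _ => (hasFDerivAt_tensorLegendre k η).const_mul (coeff g k))
      (fun k η hη => hgv k η (hBρ η hη)) hη
      (Summable.of_norm_bounded hu fun k => hgu k η (openCube_subset_cube N (hBcube hη))) hη
    refine (h.congr_of_eventuallyEq ?_).fderiv
    filter_upwards [hB.mem_nhds hη] with ζ hζ
    exact (tsum_coeff_mul_tensorLegendre hg.continuousOn hu hgu (hBcube hζ)).symm
  have hunif := tendstoUniformlyOn_tsum (f := fun k θ => coeff g k • tensorLegendreDeriv k θ)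
    (s := B) hv fun k η hη => hgv k η (hBρ η hη)
  have hs1 : (1 : WithTop ℕ∞) ≤ s := by
    have : (1 : ℝ) ≤ s := by
      have : (0 : ℝ) ≤ N := Nat.cast_nonneg N
      linarith
    exact_mod_cast this
  have hcont : ContinuousAt (fderiv ℝ g) θ :=
    ((hg.mono (hBcube.trans (openCube_subset_cube N))).continuousOn_fderiv_of_isOpen hB
      hs1).continuousAt (hB.mem_nhds hθB)
  rw [Metric.tendsto_nhds]
  intro ε hε
  -- The joint limit splits into uniform convergence on `B` and continuity of `fderiv ℝ g` at `θ`.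
  have e1 : ∀ᶠ M in atTop, ∀ η ∈ B, dist (fderiv ℝ g η) (surrogateDeriv M g η) < ε / 2 := by
    have := (tendsto_multiIndices N).eventually
      (Metric.tendstoUniformlyOn_iff.1 hunif (ε / 2) (by positivity))
    filter_upwards [this] with M hM η hη
    rw [hd η hη]
    exact hM η hη
  have e2 : ∀ᶠ η in 𝓝 θ, η ∈ B ∧ dist (fderiv ℝ g η) (fderiv ℝ g θ) < ε / 2 :=
    (hB.eventually_mem hθB).and (Metric.tendsto_nhds.1 hcont (ε / 2) (by positivity))
  filter_upwards [e1.prod_mk e2] with p hp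
  have h1 := hp.1 p.2 hp.2.1
  rw [dist_comm] at h1
  linarith [dist_triangle (surrogateDeriv p.1 g p.2) (fderiv ℝ g p.2) (fderiv ℝ g θ), hp.2.2]

end Convergence

/-! ### Persistence of nondegenerate zeros -/

section Zeros

/-- Stability of nondegenerate zeros under `C¹` perturbation. -/
theorem eventually_exists_zero {E : Type*} [NormedAddCommGroup E] [NormedSpace ℝ E]
    [CompleteSpace E] [Nontrivial E] {F : ℕ → E → E} {F' : ℕ → E → E →L[ℝ] E} {x₀ : E}
    (A : E ≃L[ℝ] E) (hF : ∀ m x, HasFDerivAt (F m) (F' m x) x)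
    (hF' : Tendsto (fun p : ℕ × E => F' p.1 p.2) (atTop ×ˢ 𝓝 x₀) (𝓝 (A : E →L[ℝ] E)))
    (h0 : Tendsto (fun m => F m x₀) atTop (𝓝 0)) {ε : ℝ} (hε : 0 < ε) :
    ∀ᶠ m in atTop, ∃ x ∈ Metric.closedBall x₀ ε, F m x = 0 := by
  have hA : 0 < ‖(A.symm : E →L[ℝ] E)‖₊ := A.nnnorm_symm_pos
  -- Half of `‖A⁻¹‖⁻¹`, so that the radius `(‖A⁻¹‖⁻¹ - c) * δ` of the ball covered by the image is
  -- `c * δ`, independent of `m`.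
  set c : NNReal := ‖(A.symm : E →L[ℝ] E)‖₊⁻¹ / 2 with hc
  have hc0 : 0 < c := by positivity
  obtain ⟨U, hU, V, hV, hUV⟩ := Filter.eventually_prod_iff.1
    (Metric.tendsto_nhds.1 hF' c (by exact_mod_cast hc0))
  obtain ⟨r, hr, hrV⟩ := Metric.nhds_basis_closedBall.mem_iff.1 hV
  set δ := min r ε
  have hδ : 0 < δ := lt_min hr hε
  have hcδ : 0 < (c : ℝ) * δ := mul_pos (by exact_mod_cast hc0) hδ
  filter_upwards [hU, Metric.tendsto_nhds.1 h0 _ hcδ] with m hm hm0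
  have happ : ApproximatesLinearOn (F m) (A : E →L[ℝ] E) (Metric.closedBall x₀ δ) c := by
    intro x hx y hy
    refine (convex_closedBall x₀ δ).norm_image_sub_le_of_norm_hasFDerivWithin_le'
      (fun z _ => (hF m z).hasFDerivWithinAt) (fun z hz => ?_) hy hx
    rw [← dist_eq_norm]
    exact (hUV hm (hrV (Metric.closedBall_subset_closedBall (min_le_left _ _) hz))).le
  have hsurj := happ.surjOn_closedBall_of_nonlinearRightInverse A.toNonlinearRightInverse hδ.le
    subset_rfl
  -- The covered ball is centred at `F m x₀`, which tends to 0, so for large `m` it contains 0.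
  have hmem : (0 : E) ∈ Metric.closedBall (F m x₀)
      (((A.toNonlinearRightInverse.nnnorm : ℝ)⁻¹ - c) * δ) := by
    have e : ((A.toNonlinearRightInverse.nnnorm : ℝ)⁻¹ - c) = c := by
      have : A.toNonlinearRightInverse.nnnorm = ‖(A.symm : E →L[ℝ] E)‖₊ := rfl
      rw [this, hc]
      push_cast
      ring
    rw [e, Metric.mem_closedBall, dist_comm]
    exact hm0.le
  obtain ⟨x, hx, hx0⟩ := hsurj hmem
  exact ⟨x, Metric.closedBall_subset_closedBall (min_le_right _ _) hx, hx0⟩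

theorem exists_equiv_of_isUnit_jacobian {N : ℕ} {f : Fin N → (Fin N → ℝ) → ℝ} {θ : Fin N → ℝ}
    (h : IsUnit (jacobian f θ)) : ∃ A : (Fin N → ℝ) ≃L[ℝ] (Fin N → ℝ),
      (A : (Fin N → ℝ) →L[ℝ] (Fin N → ℝ)) = ContinuousLinearMap.pi fun i => fderiv ℝ (f i) θ := by
  set J := jacobian f θ with hJ
  have hdet : IsUnit J.det := (Matrix.isUnit_iff_isUnit_det J).1 h
  have hmul : ∀ y, (ContinuousLinearMap.pi fun i => fderiv ℝ (f i) θ) y = J.mulVec y := by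
    intro y
    ext i
    have hy : y = ∑ j, y j • (Pi.single j 1 : Fin N → ℝ) := pi_eq_sum_univ' y
    rw [ContinuousLinearMap.pi_apply]
    conv_lhs => rw [hy]
    simp [map_sum, Matrix.mulVec, dotProduct, hJ, jacobian, mul_comm]
  refine ⟨ContinuousLinearEquiv.equivOfInverse
    (ContinuousLinearMap.pi fun i => fderiv ℝ (f i) θ) (Matrix.toLin' J⁻¹).toContinuousLinearMap
    (fun y => ?_) (fun y => ?_), ContinuousLinearMap.ext fun y => rfl⟩
  · rw [hmul]
    simp [Matrix.mulVec_mulVec, Matrix.nonsing_inv_mul J hdet]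
  · rw [hmul]
    simp [Matrix.mulVec_mulVec, Matrix.mul_nonsing_inv J hdet]

theorem eventually_exists_surrogate_zero {N s : ℕ} (hN : 0 < N)
    (hs : (3 / 2 : ℝ) * N + 2 ≤ s) {f : Fin N → (Fin N → ℝ) → ℝ}
    (hf : ∀ i, ContDiffOn ℝ (s : WithTop ℕ∞) (f i) (cube N)) {θ : Fin N → ℝ}
    (hθ : θ ∈ openCube N) (hzero : ∀ i, f i θ = 0) (hjac : IsUnit (jacobian f θ)) {ε : ℝ}
    (hε : 0 < ε) :
    ∀ᶠ M in atTop, ∃ η ∈ cube N, dist η θ ≤ ε ∧ ∀ i, surrogate M (f i) η = 0 := by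
  have : Nonempty (Fin N) := ⟨⟨0, hN⟩⟩
  obtain ⟨A, hA⟩ := exists_equiv_of_isUnit_jacobian hjac
  obtain ⟨r, hr, hrc⟩ := Metric.nhds_basis_closedBall.mem_iff.1 (cube_mem_nhds hθ)
  have key := eventually_exists_zero (F := fun M η i => surrogate M (f i) η)
    (F' := fun M η => ContinuousLinearMap.pi fun i => surrogateDeriv M (f i) η) (x₀ := θ) A
    (fun M η => hasFDerivAt_pi.2 fun i => hasFDerivAt_surrogate M (f i) η) ?_ ?_
    (lt_min hr hε)
  · filter_upwards [key] with M hM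
    obtain ⟨η, hη, h0⟩ := hM
    exact ⟨η, hrc (Metric.closedBall_subset_closedBall (min_le_left _ _) hη),
      (Metric.mem_closedBall.1 hη).trans (min_le_right _ _), fun i => congrFun h0 i⟩
  · rw [hA, Metric.tendsto_nhds]
    intro δ hδ
    have := eventually_all.2 fun i => Metric.tendsto_nhds.1
      (tendsto_surrogateDeriv hN hs (hf i) hθ) (δ / 2) (by positivity)
    filter_upwards [this] with p hp
    have e : (ContinuousLinearMap.pi fun i => surrogateDeriv p.1 (f i) p.2)
        - (ContinuousLinearMap.pi fun i => fderiv ℝ (f i) θ)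
        = ContinuousLinearMap.pi fun i => surrogateDeriv p.1 (f i) p.2 - fderiv ℝ (f i) θ := by
      ext; simp
    rw [dist_eq_norm, e]
    refine lt_of_le_of_lt (ContinuousLinearMap.norm_pi_le_of_le (fun i => ?_) (by positivity))
      (half_lt_self hδ)
    rw [← dist_eq_norm]
    exact (hp i).le
  · refine tendsto_pi_nhds.2 fun i => ?_
    have := tendsto_surrogate hN hs (hf i) hθ
    rwa [hzero i] at this

end Zeros

end LegendreSurrogate
end

/-! ### Minimizers of the surrogate least-squares problem -/

theorem theorem1 (N : ℕ) (f : Fin N → (Fin N → ℝ) → ℝ) (θd : Fin N → ℝ)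
    (hf : ∀ i, ContDiffOn ℝ ((⌈(3 / 2 : ℝ) * (N : ℝ)⌉₊ + 2 : ℕ) : WithTop ℕ∞) (f i)
      (LegendreSurrogate.cube N))
    (hθd : ∀ j, θd j ∈ Set.Ioo (-1 : ℝ) 1)
    (hzero : ∀ i, f i θd = 0)
    (hjac : IsUnit (LegendreSurrogate.jacobian f θd)) :
    ∃ θs : ℕ → (Fin N → ℝ),
      (∀ M, θs M ∈ LegendreSurrogate.cube N ∧
        IsMinOn (fun θ => ∑ i, (LegendreSurrogate.surrogate M (f i) θ) ^ 2)
          (LegendreSurrogate.cube N) (θs M)) ∧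
      Tendsto θs atTop (𝓝 θd) ∧
      Tendsto (fun M => fun i => LegendreSurrogate.surrogate M (f i) (θs M)) atTop (𝓝 0) := by
  open LegendreSurrogate in
  rcases Nat.eq_zero_or_pos N with rfl | hN
  · refine ⟨fun _ => θd, fun M => ⟨fun j => j.elim0, fun θ _ => by simp⟩, tendsto_const_nhds, ?_⟩
    exact tendsto_pi_nhds.2 fun j => j.elim0
  have hθ : θd ∈ openCube N := fun j _ => hθd j
  have hs : (3 / 2 : ℝ) * N + 2 ≤ ((⌈(3 / 2 : ℝ) * (N : ℝ)⌉₊ + 2 : ℕ) : ℝ) := by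
    push_cast
    linarith [Nat.le_ceil ((3 / 2 : ℝ) * (N : ℝ))]
  let Φ : ℕ → (Fin N → ℝ) → ℝ := fun M θ => ∑ i, (surrogate M (f i) θ) ^ 2
  have hΦc : ∀ M, Continuous (Φ M) := fun M =>
    continuous_finsetSum _ fun i _ => (continuous_surrogate M (f i)).pow 2
  -- Among the minimizers choose one that is closest to `θd`.
  have hex : ∀ M, ∃ θ, (θ ∈ cube N ∧ IsMinOn (Φ M) (cube N) θ) ∧
      ∀ η, η ∈ cube N → IsMinOn (Φ M) (cube N) η → dist θ θd ≤ dist η θd := by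
    intro M
    obtain ⟨θ₀, hθ₀, hmin⟩ := (isCompact_cube N).exists_isMinOn
      ⟨θd, openCube_subset_cube N hθ⟩ (hΦc M).continuousOn
    -- The minimizers form a sublevel set at the minimal value; it is compact, so the distance to
    -- `θd` attains its minimum there.
    have hS : IsCompact (cube N ∩ {θ | Φ M θ ≤ Φ M θ₀}) :=
      (isCompact_cube N).inter_right (isClosed_le (hΦc M) continuous_const)
    obtain ⟨θ, ⟨hθ1, hθ2⟩, hθ3⟩ := hS.exists_isMinOn ⟨θ₀, hθ₀, le_refl (Φ M θ₀)⟩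
      (f := fun θ => dist θ θd) (by fun_prop)
    have hθ2' : Φ M θ ≤ Φ M θ₀ := hθ2
    refine ⟨θ, ⟨hθ1, isMinOn_iff.2 fun η hη => hθ2'.trans (isMinOn_iff.1 hmin η hη)⟩,
      fun η hη hηm => isMinOn_iff.1 hθ3 η ⟨hη, isMinOn_iff.1 hηm θ₀ hθ₀⟩⟩
  choose θs hθs hclose using hex
  have hzero_min : ∀ M η, (∀ i, surrogate M (f i) η = 0) → Φ M η = 0 := fun M η h => by
    simp [Φ, h]
  have hnonneg : ∀ M η, 0 ≤ Φ M η := fun M η => Finset.sum_nonneg fun i _ => sq_nonneg _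
  refine ⟨θs, hθs, ?_, ?_⟩
  · rw [Metric.tendsto_nhds]
    intro ε hε
    filter_upwards [eventually_exists_surrogate_zero hN hs hf hθ hzero hjac (half_pos hε)]
      with M hM
    obtain ⟨η, hη, hd, h0⟩ := hM
    -- A common zero is a global minimizer, so the chosen minimizer is at least as close to `θd`.
    have := hclose M η hη fun ζ _ => by
      change Φ M η ≤ Φ M ζ
      rw [hzero_min M η h0]
      exact hnonneg M ζ
    linarith
  · refine tendsto_const_nhds.congr' ?_
    -- Only the existence of a common zero in the cube matters here; the radius 1 is arbitrary. The
    -- surrogates at `θs M` are eventually exactly zero.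
    filter_upwards [eventually_exists_surrogate_zero hN hs hf hθ hzero hjac one_pos] with M hM
    obtain ⟨η, hη, -, h0⟩ := hM
    have h1 : Φ M (θs M) ≤ 0 := ((hθs M).2 hη).trans_eq (hzero_min M η h0)
    have h2 : Φ M (θs M) = 0 := le_antisymm h1 (hnonneg M _)
    ext i
    have := (Finset.sum_eq_zero_iff_of_nonneg fun i _ => sq_nonneg _).1 h2 i (Finset.mem_univ i)
    exact (pow_eq_zero_iff two_ne_zero |>.1 this).symm
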